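/- For an integer $N\ge 1$, let $\mathbf{SP}(N)$ be the spider with $N$ legs: its vertices are the points $v_N(r,j)$, $r=0,1,2,\dots$, $j=1,\dots,N$ (height $r$ on leg $j$), where $v_N(0,1)=\dots=v_N(0,N)$ is a single vertex, the body, and all other vertices are distinct. Let $\mathbf S_0,\mathbf S_1,\mathbf S_2,\dots$ be the random walk on $\mathbf{SP}(N)$ with equal leg probabilities, i.e. the Markov chain started at the body that moves from the body to $v_N(1,j)$ with probability $1/N$ for each $j$, and from $v_N(r,j)$, $r\ge 1$, to $v_N(r+1,j)$ or $v_N(r-1,j)$ with probability $1/2$ each. For integers $n,L\ge 0$ let $$\xi(v_N(L,j),n)=\#\{k:\ 0\le k\le n,\ \mathbf S_k=v_N(L,j)\},\qquad M(n,L)=\Big\{\min_{1\le j\le N}\xi(v_N(L,j),n)\ge 1\Big\},$$ so that $M(n,L)$ is the event that within $n$ steps the walk reaches height $L$ on every leg. **Theorem 5.3.** Let $(L_N)$ be any sequence of nonnegative integers with $L_N\le N/\log N$ for all $N\ge 2$, and let $(f(N))$ be any sequence of real numbers with $f(N)\to\infty$ as $N\to\infty$. Then, for the random walk on $\mathbf{SP}(N)$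 with equal leg probabilities, $$\lim_{N\to\infty}\mathbf P\Big(M\big(\big[(f(N)\,L_N\,N\log N)^2\big],\,L_N\big)\Big)=1,$$ where $[\cdot]$ denotes the integer part. -/

import Mathlib

open Filter Topology MeasureTheory

/-- Vertices of the spider with `N` legs: the body, and `leg j r`, the vertex at height `r + 1`
on leg `j`. -/
inductive SpiderVertex (N : ℕ) : Type
  | body : SpiderVertex N
  | leg (j : Fin N) (r : ℕ) : SpiderVertex N
  deriving DecidableEq

/-- The discrete sigma-algebra on the (countable) vertex set. -/
instance (N : ℕ) : MeasurableSpace (SpiderVertex N) := ⊤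

/-- The vertex `v_N(r, j)` at height `r` on leg `j`; for `r = 0` it is the body, whatever `j` is. -/
def spiderPoint {N : ℕ} : ℕ → Fin N → SpiderVertex N
  | 0, _ => SpiderVertex.body
  | r + 1, j => SpiderVertex.leg j r

/-- One-step transition probabilities of the random walk on the spider with leg probabilities `p`:
from the body to height `1` on leg `j` with probability `p j`; from a vertex of height at least `1`
one step up or one step down on the same leg, with probability `1 / 2` each. -/
noncomputable def spiderTransition {N : ℕ} (p : Fin N → ℝ) :
    SpiderVertex N → SpiderVertex N → ℝ
  | .body, .body => 0
  | .body, .leg j r => if r = 0 then p j else 0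
  | .leg _ r, .body => if r = 0 then 1 / 2 else 0
  | .leg i r, .leg j s => if i = j ∧ (s = r + 1 ∨ r = s + 1) then 1 / 2 else 0

/-- `S 0, S 1, …` is a random walk on the spider with leg probabilities `p`, on the probability
space `(Ω, μ)`: a Markov chain started at the body with transition probabilities
`spiderTransition p`. -/
structure IsSpiderWalk {N : ℕ} {Ω : Type*} [MeasurableSpace Ω] (μ : Measure Ω) (p : Fin N → ℝ)
    (S : ℕ → Ω → SpiderVertex N) : Prop where
  prob : IsProbabilityMeasure μ
  nonneg : ∀ j, 0 ≤ p j
  sum_eq_one : ∑ j, p j = 1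
  measurable : ∀ k, Measurable (S k)
  start : ∀ᵐ ω ∂μ, S 0 ω = SpiderVertex.body
  markov : ∀ (n : ℕ) (x : ℕ → SpiderVertex N),
    μ.real {ω | ∀ k ≤ n + 1, S k ω = x k} =
      μ.real {ω | ∀ k ≤ n, S k ω = x k} * spiderTransition p (x n) (x (n + 1))

/-- The local time `ξ(v, n) = #{k : 0 ≤ k ≤ n, S_k = v}`. -/
def spiderLocalTime {N : ℕ} {Ω : Type*} (S : ℕ → Ω → SpiderVertex N) (v : SpiderVertex N)
    (n : ℕ) (ω : Ω) : ℕ :=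
  ((Finset.range (n + 1)).filter (fun k => S k ω = v)).card

/-- The event `M(n, L)` that `min_j ξ(v(L, j), n) ≥ 1`: within `n` steps the walk reaches
height `L` on every leg. -/
def spiderReachEvent {N : ℕ} {Ω : Type*} (S : ℕ → Ω → SpiderVertex N) (n L : ℕ) : Set Ω :=
  {ω | ∀ j : Fin N, 1 ≤ spiderLocalTime S (spiderPoint L j) n ω}

/-!
Count time in visits of the walk to the body, each of which starts an excursion into a uniformly
chosen leg. An excursion reaches height `L` on a given leg with probability `q = 1 / (N L)`, so about
`m = 3 N L log N` excursions reach height `L` on all legs, as in the coupon collector problem; and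
`m` excursions rarely last longer than `(f N L log N) ^ 2` steps when `f` is large, because the
number of visits to the body before time `n` is of order `√n`. Both facts come from an explicit
(super)martingale, so that neither excursions nor stopping times need to be constructed.

* For the covering of leg `j`, let `h` be `1 - r / L` at height `r ≤ L` of leg `j` and `1` elsewhere.
  Its average over a step from the body is `1 - q`, so `h (S n) / (1 - q) ^ (visits before n)`, killed
  at height `L` of leg `j`, is a supermartingale. As `h ≥ 1 / L` off the killing point, the leg is
  missed during `m` excursions with probability at most `L (1 - q) ^ m ≤ L / N ^ 3`
  (`IsSpiderWalk.measureReal_not_visited_le`), which the bound `L ≤ N / log N ≤ N` lets us sum over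
  the `N` legs.
* For the number of visits, `s ^ n * a ^ (-visits before n) * b ^ height` is a martingale when
  `s = 2 b / (1 + b ^ 2)` and `a = s b`. Stopping it at the `m`-th visit gives
  `a ^ m ≤ s ^ n P + (1 - P)`, where `P` is the probability of fewer than `m` visits before time `n`.
  With `b = 1 - δ` and `δ` of order `1 / √n` this yields `P = O(m / √n)`
  (`IsSpiderWalk.measureReal_bodyVisits_lt_le`).

The one probabilistic input is the Markov property in integrated form,
`IsSpiderWalk.lintegral_step`. When `L = 0` the body itself is the target, visited at time `0`.
-/

/-! ### The one-step averaging operator and the Markov property -/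

instance (N : ℕ) : DiscreteMeasurableSpace (SpiderVertex N) := ⟨fun _ => trivial⟩

instance (N : ℕ) : Countable (SpiderVertex N) := by
  have : Function.Injective
      (fun v : SpiderVertex N => match v with
        | .body => (none : Option (Fin N × ℕ))
        | .leg j r => some (j, r)) := by
    intro v w h
    cases v <;> cases w <;> simp_all
  exact this.countable

/-- The distance of a vertex from the body. -/
def spiderHeight {N : ℕ} : SpiderVertex N → ℕ
  | .body => 0
  | .leg _ r => r + 1

/-- The number of visits of the path `x` to the body strictly before time `n`. -/
def bodyVisits {N : ℕ} (x : ℕ → SpiderVertex N) (n : ℕ) : ℕ :=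
  ((Finset.range n).filter (fun k => x k = SpiderVertex.body)).card

/-- The averaging operator of the walk: `spiderAverage p φ v` is the expected value of `φ` after
one step from `v`. -/
noncomputable def spiderAverage {N : ℕ} (p : Fin N → ℝ) (φ : SpiderVertex N → ℝ) :
    SpiderVertex N → ℝ
  | .body => ∑ j, p j * φ (.leg j 0)
  | .leg j r => (φ (.leg j (r + 1)) + φ (spiderPoint r j)) / 2

theorem spiderTransition_nonneg {N : ℕ} {p : Fin N → ℝ} (hp : ∀ j, 0 ≤ p j)
    (v w : SpiderVertex N) : 0 ≤ spiderTransition p v w := by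
  cases v <;> cases w <;> simp only [spiderTransition] <;>
    first | exact le_rfl | (split_ifs <;> first | exact hp _ | norm_num)

theorem tsum_spiderTransition_mul {N : ℕ} {p : Fin N → ℝ} (hp : ∀ j, 0 ≤ p j)
    {φ : SpiderVertex N → ℝ} (hφ : ∀ v, 0 ≤ φ v) (v : SpiderVertex N) :
    ∑' w, ENNReal.ofReal (spiderTransition p v w) * ENNReal.ofReal (φ w) =
      ENNReal.ofReal (spiderAverage p φ v) := by
  simp_rw [← ENNReal.ofReal_mul (spiderTransition_nonneg hp v _)]
  cases v with
  | body =>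
    let e : Fin N ↪ SpiderVertex N := ⟨fun j => .leg j 0, fun i j h => by simpa using h⟩
    rw [tsum_eq_sum (s := Finset.univ.map e), Finset.sum_map,
      ← ENNReal.ofReal_sum_of_nonneg]
    · have he : ∀ j, e j = .leg j 0 := fun _ => rfl
      simp only [he, spiderTransition, if_true, spiderAverage]
    · intro j _
      exact mul_nonneg (spiderTransition_nonneg hp _ _) (hφ _)
    · intro w hw
      cases w with
      | body => simp [spiderTransition]
      | leg j r =>
        have : r ≠ 0 := by
          rintro rfl
          exact hw (Finset.mem_map_of_mem e (Finset.mem_univ j))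
        simp [spiderTransition, this]
  | leg j r =>
    have hne : SpiderVertex.leg j (r + 1) ≠ spiderPoint r j := by
      cases r
      · simp [spiderPoint]
      · simp only [spiderPoint, ne_eq, SpiderVertex.leg.injEq, true_and]
        omega
    rw [tsum_eq_sum (s := {SpiderVertex.leg j (r + 1), spiderPoint r j}),
      Finset.sum_pair hne, ← ENNReal.ofReal_add]
    · congr 1
      cases r <;> simp [spiderTransition, spiderAverage, spiderPoint] <;> ring
    · exact mul_nonneg (spiderTransition_nonneg hp _ _) (hφ _)
    · exact mul_nonneg (spiderTransition_nonneg hp _ _) (hφ _)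
    · intro w hw
      simp only [Finset.mem_insert, Finset.mem_singleton, not_or] at hw
      have : spiderTransition p (.leg j r) w = 0 := by
        cases w with
        | body =>
          cases r
          · exact absurd rfl hw.2
          · simp [spiderTransition]
        | leg i s =>
          simp only [spiderTransition, ite_eq_right_iff]
          rintro ⟨rfl, rfl | rfl⟩
          · exact absurd rfl hw.1
          · exact absurd rfl hw.2
      simp [this]

/-- A quantity that depends on finitely many positions of the walk is measurable, whatever the
function, because there are only countably many finite paths. -/
theorem IsSpiderWalk.measurable_path {N : ℕ} {Ω : Type*} [MeasurableSpace Ω] {μ : Measure Ω}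
    {p : Fin N → ℝ} {S : ℕ → Ω → SpiderVertex N} (hS : IsSpiderWalk μ p S) {β : Type*}
    [MeasurableSpace β] {n : ℕ} {F : (ℕ → SpiderVertex N) → β} (hF : DependsOn F (Set.Iic n)) :
    Measurable fun ω => F fun k => S k ω := by
  have h : (fun ω => F fun k => S k ω) =
      (fun u : Fin (n + 1) → SpiderVertex N => F fun k => u ⟨min k n, by omega⟩) ∘
        fun ω (i : Fin (n + 1)) => S i ω := by
    funext ω
    refine hF fun k hk => ?_
    simp [min_eq_left (Set.mem_Iic.1 hk)]
  rw [h]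
  exact (Measurable.of_discrete).comp (measurable_pi_lambda _ fun i => hS.measurable i)

/-- The Markov property, integrated: the last of `n + 2` positions may be averaged out against any
nonnegative function of the earlier ones. It follows from the cylinder probabilities because there
are only countably many paths of a given length. -/
theorem IsSpiderWalk.lintegral_step {N : ℕ} {Ω : Type*} [MeasurableSpace Ω] {μ : Measure Ω}
    {p : Fin N → ℝ} {S : ℕ → Ω → SpiderVertex N} (hS : IsSpiderWalk μ p S) {n : ℕ}
    {F : (ℕ → SpiderVertex N) → ℝ} (hF : DependsOn F (Set.Iic n)) (hF0 : ∀ x, 0 ≤ F x)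
    {φ : SpiderVertex N → ℝ} (hφ : ∀ v, 0 ≤ φ v) :
    ∫⁻ ω, ENNReal.ofReal (F (fun k => S k ω) * φ (S (n + 1) ω)) ∂μ =
      ∫⁻ ω, ENNReal.ofReal (F (fun k => S k ω) * spiderAverage p φ (S n ω)) ∂μ := by
  have := hS.prob
  -- Extend a path of length `n + 1` to all times by keeping it constant; `F` does not notice.
  let e : (Fin (n + 1) → SpiderVertex N) → ℕ → SpiderVertex N := fun u k => u ⟨min k n, by omega⟩
  let X : Ω → Fin (n + 1) → SpiderVertex N := fun ω i => S i ω
  have hX : Measurable X := measurable_pi_lambda _ fun i => hS.measurable i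
  have hFX : ∀ ω, F (fun k => S k ω) = F (e (X ω)) := fun ω => hF fun k hk => by
    simp [e, X, min_eq_left (Set.mem_Iic.1 hk)]
  have hlast : ∀ ω, S n ω = X ω (Fin.last n) := fun ω => rfl
  have hprob : ∀ u y, μ ((fun ω => (X ω, S (n + 1) ω)) ⁻¹' {(u, y)}) =
      μ (X ⁻¹' {u}) * ENNReal.ofReal (spiderTransition p (u (Fin.last n)) y) := by
    intro u y
    have h := hS.markov n fun k => if h : k ≤ n then u ⟨k, by omega⟩ else y
    have h1 : {ω | ∀ k ≤ n + 1, S k ω = if h : k ≤ n then u ⟨k, by omega⟩ else y} =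
        (fun ω => (X ω, S (n + 1) ω)) ⁻¹' {(u, y)} := by
      ext ω
      simp only [Set.mem_ofPred_eq, Set.mem_preimage, Set.mem_singleton_iff, Prod.mk.injEq,
        funext_iff, X]
      constructor
      · intro hk
        refine ⟨fun i => ?_, ?_⟩
        · have := hk i (by omega)
          rwa [dif_pos (by omega)] at this
        · have := hk (n + 1) le_rfl
          rwa [dif_neg (by omega)] at this
      · rintro ⟨hi, hy⟩ k hk
        split_ifs with hkn
        · exact hi ⟨k, by omega⟩
        · obtain rfl : k = n + 1 := by omega
          exact hy
    have h2 : {ω | ∀ k ≤ n, S k ω = if h : k ≤ n then u ⟨k, by omega⟩ else y} = X ⁻¹' {u} := by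
      ext ω
      simp only [Set.mem_ofPred_eq, Set.mem_preimage, Set.mem_singleton_iff, funext_iff, X]
      constructor
      · intro hk i
        have := hk i (by omega)
        rwa [dif_pos (by omega)] at this
      · intro hi k hk
        rw [dif_pos hk]
        exact hi ⟨k, by omega⟩
    rw [h1, h2] at h
    rw [dif_pos le_rfl, dif_neg (by omega)] at h
    rw [← ENNReal.ofReal_toReal (measure_ne_top μ (X ⁻¹' {u})),
      ← ENNReal.ofReal_mul ENNReal.toReal_nonneg,
      ← ENNReal.ofReal_toReal (measure_ne_top μ ((fun ω => (X ω, S (n + 1) ω)) ⁻¹' {(u, y)}))]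
    exact congrArg ENNReal.ofReal h
  have hXS : Measurable fun ω => (X ω, S (n + 1) ω) := hX.prodMk (hS.measurable _)
  have hL : ∫⁻ ω, ENNReal.ofReal (F (fun k => S k ω) * φ (S (n + 1) ω)) ∂μ =
      ∑' u, ∑' y, ENNReal.ofReal (F (e u) * φ y) *
        μ ((fun ω => (X ω, S (n + 1) ω)) ⁻¹' {(u, y)}) := by
    simp_rw [hFX]
    rw [← lintegral_map (f := fun q : (Fin (n + 1) → SpiderVertex N) × SpiderVertex N =>
      ENNReal.ofReal (F (e q.1) * φ q.2)) Measurable.of_discrete hXS, lintegral_countable',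
      ENNReal.tsum_prod']
    simp_rw [Measure.map_apply hXS (MeasurableSet.of_discrete)]
  have hR : ∫⁻ ω, ENNReal.ofReal (F (fun k => S k ω) * spiderAverage p φ (S n ω)) ∂μ =
      ∑' u, ENNReal.ofReal (F (e u) * spiderAverage p φ (u (Fin.last n))) * μ (X ⁻¹' {u}) := by
    simp_rw [hFX, hlast]
    rw [← lintegral_map (f := fun u : Fin (n + 1) → SpiderVertex N =>
      ENNReal.ofReal (F (e u) * spiderAverage p φ (u (Fin.last n)))) Measurable.of_discrete hX,
      lintegral_countable']
    simp_rw [Measure.map_apply hX (MeasurableSet.of_discrete)]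
  rw [hL, hR]
  refine tsum_congr fun u => ?_
  rw [ENNReal.ofReal_mul (hF0 _), ← tsum_spiderTransition_mul hS.nonneg hφ, ← ENNReal.tsum_mul_left,
    ← ENNReal.tsum_mul_right]
  refine tsum_congr fun y => ?_
  rw [hprob, ENNReal.ofReal_mul (hF0 _)]
  ring

theorem bodyVisits_succ {N : ℕ} (x : ℕ → SpiderVertex N) (n : ℕ) :
    bodyVisits x (n + 1) = bodyVisits x n + if x n = SpiderVertex.body then 1 else 0 := by
  unfold bodyVisits
  rw [Finset.range_add_one, Finset.filter_insert]
  split_ifs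
  · rw [Finset.card_insert_of_notMem (by simp)]
  · rfl

theorem bodyVisits_zero {N : ℕ} (x : ℕ → SpiderVertex N) : bodyVisits x 0 = 0 := rfl

theorem dependsOn_bodyVisits {N : ℕ} (n : ℕ) :
    DependsOn (fun x : ℕ → SpiderVertex N => bodyVisits x (n + 1)) (Set.Iic n) := by
  intro x y h
  simp only [bodyVisits]
  congr 1
  refine Finset.filter_congr fun k hk => ?_
  rw [h k (Set.mem_Iic.2 (Nat.lt_succ_iff.1 (Finset.mem_range.1 hk)))]

theorem dependsOn_not_visited {N : ℕ} (n : ℕ) (v : SpiderVertex N) :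
    DependsOn (fun x : ℕ → SpiderVertex N => ∀ k ≤ n, x k ≠ v) (Set.Iic n) := by
  intro x y h
  simp only [eq_iff_iff]
  exact forall₂_congr fun k hk => by rw [h k hk]

/-! ### Missing a leg during many excursions -/

/-- The weight of the leg `j` below height `L`: it is harmonic away from the body and from the
vertex at height `L` on leg `j`, where the walk is killed. Above that vertex the weight is set to
`1`, so that it is at least `1 / L` at every other vertex and no continuity of paths is needed. -/
noncomputable def legWeight {N : ℕ} (L : ℕ) (j : Fin N) : SpiderVertex N → ℝ
  | .body => 1
  | .leg i r => if i = j ∧ r + 1 ≤ L then 1 - (r + 1 : ℝ) / L else 1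

theorem legWeight_nonneg {N : ℕ} (L : ℕ) (j : Fin N) (v : SpiderVertex N) :
    0 ≤ legWeight L j v := by
  cases v with
  | body => exact zero_le_one
  | leg i r =>
    simp only [legWeight]
    split_ifs with h
    · rw [sub_nonneg]
      exact div_le_one_of_le₀ (by exact_mod_cast h.2) (Nat.cast_nonneg _)
    · exact zero_le_one

theorem legWeight_le_one {N : ℕ} (L : ℕ) (j : Fin N) (v : SpiderVertex N) :
    legWeight L j v ≤ 1 := by
  cases v with
  | body => exact le_rfl
  | leg i r =>
    simp only [legWeight]
    split_ifs with h
    · rw [sub_le_self_iff]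
      positivity
    · exact le_rfl

theorem inv_le_legWeight {N : ℕ} {L : ℕ} (hL : 1 ≤ L) {j : Fin N} {v : SpiderVertex N}
    (hv : v ≠ spiderPoint L j) : 1 / (L : ℝ) ≤ legWeight L j v := by
  have hL' : (1 : ℝ) ≤ L := by exact_mod_cast hL
  have h1 : 1 / (L : ℝ) ≤ 1 := div_le_one_of_le₀ hL' (by linarith)
  cases v with
  | body => exact h1
  | leg i r =>
    simp only [legWeight]
    split_ifs with h
    · obtain ⟨rfl, hr⟩ := h
      have hne : r + 1 ≠ L := by
        rintro rfl
        exact hv rfl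
      have : (r : ℝ) + 1 + 1 ≤ L := by exact_mod_cast (by omega : r + 1 + 1 ≤ L)
      rw [le_sub_iff_add_le, ← add_div]
      exact div_le_one_of_le₀ (by linarith) (by linarith)
    · exact h1

theorem spiderAverage_legWeight_body {N : ℕ} {L : ℕ} (hL : 1 ≤ L) (hN : 1 ≤ N) (j : Fin N) :
    spiderAverage (fun _ : Fin N => 1 / (N : ℝ)) (legWeight L j) .body = 1 - 1 / (N * L : ℝ) := by
  have h : ∀ i : Fin N, 1 / (N : ℝ) * legWeight L j (.leg i 0) =
      1 / N - if i = j then 1 / (N * L : ℝ) else 0 := by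
    intro i
    simp only [legWeight, zero_add, hL, and_true]
    split_ifs
    · push_cast
      field_simp
      simp
    · simp
  have hN' : (N : ℝ) ≠ 0 := by exact_mod_cast (by omega : N ≠ 0)
  simp only [spiderAverage, h]
  rw [Finset.sum_sub_distrib, Finset.sum_ite_eq' Finset.univ j]
  simp [hN']

theorem spiderAverage_legWeight_le {N : ℕ} {L : ℕ} (hL : 1 ≤ L) (p : Fin N → ℝ) (j : Fin N)
    {v : SpiderVertex N} (hb : v ≠ .body) (hv : v ≠ spiderPoint L j) :
    spiderAverage p (legWeight L j) v ≤ legWeight L j v := by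
  cases v with
  | body => exact absurd rfl hb
  | leg i r =>
    simp only [spiderAverage]
    by_cases h : i = j ∧ r + 1 ≤ L
    · obtain ⟨rfl, hr⟩ := h
      have hne : r + 1 ≠ L := by
        rintro rfl
        exact hv rfl
      have hr' : r + 1 + 1 ≤ L := by omega
      have hL0 : (L : ℝ) ≠ 0 := by exact_mod_cast (by omega : L ≠ 0)
      cases r with
      | zero =>
        simp only [legWeight, spiderPoint, hr, hr', and_self, if_true]
        push_cast
        field_simp
        linarith
      | succ r =>
        have hr'' : r + 1 ≤ L := by omega
        simp only [legWeight, spiderPoint, hr, hr', hr'', and_self, if_true]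
        push_cast
        field_simp
        linarith
    · have h1 := legWeight_le_one L j (.leg i (r + 1))
      have h2 := legWeight_le_one L j (spiderPoint r i)
      have h3 : legWeight L j (.leg i r) = 1 := by simp only [legWeight, if_neg h]
      rw [h3]
      linarith

open Classical in
/-- With `q = 1 / (N L)` the chance that one excursion from the body reaches height `L` on leg `j`,
the process `legWeight (S n) / (1 - q) ^ bodyVisits n`, killed at that vertex, is a
supermartingale. -/
theorem IsSpiderWalk.lintegral_legWeight_le_one {N : ℕ} {Ω : Type*} [MeasurableSpace Ω]
    {μ : Measure Ω} {S : ℕ → Ω → SpiderVertex N}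
    (hS : IsSpiderWalk μ (fun _ : Fin N => 1 / (N : ℝ)) S) (hN : 2 ≤ N) {L : ℕ} (hL : 1 ≤ L)
    (j : Fin N) (n : ℕ) :
    ∫⁻ ω, ENNReal.ofReal ((if ∀ k ≤ n, S k ω ≠ spiderPoint L j then
      ((1 - 1 / (N * L : ℝ)) ^ bodyVisits (fun k => S k ω) n)⁻¹ else 0) *
        legWeight L j (S n ω)) ∂μ ≤ 1 := by
  have := hS.prob
  have hNL : (1 : ℝ) < N * L := by
    have : (2 : ℝ) ≤ N := by exact_mod_cast hN
    have : (1 : ℝ) ≤ L := by exact_mod_cast hL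
    nlinarith
  have hq : (0 : ℝ) < 1 - 1 / (N * L : ℝ) := by
    rw [sub_pos, div_lt_one (by linarith)]
    exact hNL
  set c : ℝ := 1 - 1 / (N * L : ℝ) with hc
  induction n with
  | zero =>
    -- The start at the body is not needed here, as the weight is at most `1` everywhere.
    refine (lintegral_mono (g := fun _ => 1) fun ω => ?_).trans (by simp)
    rw [ENNReal.ofReal_le_one, bodyVisits_zero]
    split_ifs
    · simpa using legWeight_le_one L j (S 0 ω)
    · simp
  | succ n ih =>
    let F : (ℕ → SpiderVertex N) → ℝ := fun x =>
      if ∀ k ≤ n, x k ≠ spiderPoint L j then (c ^ bodyVisits x (n + 1))⁻¹ else 0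
    have hF : DependsOn F (Set.Iic n) := by
      intro x y h
      have h1 := dependsOn_not_visited n (spiderPoint L j) h
      have h2 := dependsOn_bodyVisits n h
      simp only [F]
      simp only at h1 h2
      rw [h2]
      simp only [h1]
    have hF0 : ∀ x, 0 ≤ F x := by
      intro x
      simp only [F]
      split_ifs <;> positivity
    calc
      _ ≤ ∫⁻ ω, ENNReal.ofReal (F (fun k => S k ω) * legWeight L j (S (n + 1) ω)) ∂μ := by
        refine lintegral_mono fun ω => ENNReal.ofReal_le_ofReal ?_
        refine mul_le_mul_of_nonneg_right ?_ (legWeight_nonneg _ _ _)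
        simp only [F]
        split_ifs with h1 h2
        · exact le_rfl
        · exact absurd (fun k hk => h1 k (by omega)) h2
        · positivity
        · exact le_rfl
      _ = _ := hS.lintegral_step hF hF0 (legWeight_nonneg L j)
      _ ≤ _ := by
        refine lintegral_mono fun ω => ENNReal.ofReal_le_ofReal ?_
        simp only [F, bodyVisits_succ]
        split_ifs with h1 h2
        · rw [h2, spiderAverage_legWeight_body hL (by omega), ← hc, pow_succ]
          simp only [legWeight]
          field_simp
          exact le_rfl
        · exact mul_le_mul_of_nonneg_left
            (spiderAverage_legWeight_le hL _ j h2 (h1 n le_rfl)) (by positivity)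
        · simp
      _ ≤ 1 := ih

/-- Within `m` excursions the walk misses height `L` on leg `j` with probability at most
`L (1 - 1 / (N L)) ^ m`; the factor `L` is the price of stopping inside an excursion. -/
theorem IsSpiderWalk.measureReal_not_visited_le {N : ℕ} {Ω : Type*} [MeasurableSpace Ω]
    {μ : Measure Ω} {S : ℕ → Ω → SpiderVertex N}
    (hS : IsSpiderWalk μ (fun _ : Fin N => 1 / (N : ℝ)) S) (hN : 2 ≤ N) {L : ℕ} (hL : 1 ≤ L)
    (j : Fin N) (n m : ℕ) :
    μ.real {ω | (∀ k ≤ n, S k ω ≠ spiderPoint L j) ∧ m ≤ bodyVisits (fun k => S k ω) n} ≤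
      L * (1 - 1 / (N * L : ℝ)) ^ m := by
  classical
  have := hS.prob
  have hNL : (1 : ℝ) < N * L := by
    have : (2 : ℝ) ≤ N := by exact_mod_cast hN
    have : (1 : ℝ) ≤ L := by exact_mod_cast hL
    nlinarith
  have hq : (0 : ℝ) < 1 - 1 / (N * L : ℝ) := by
    rw [sub_pos, div_lt_one (by linarith)]
    exact hNL
  have hq1 : 1 - 1 / (N * L : ℝ) ≤ 1 := by
    rw [sub_le_self_iff]
    positivity
  have hL0 : (0 : ℝ) < L := by exact_mod_cast hL
  have key := hS.lintegral_legWeight_le_one hN hL j n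
  set c : ℝ := 1 - 1 / (N * L : ℝ) with hc
  set E := {ω | (∀ k ≤ n, S k ω ≠ spiderPoint L j) ∧ m ≤ bodyVisits (fun k => S k ω) n}
  have hsub : E ⊆ {ω | ENNReal.ofReal ((c ^ m)⁻¹ * (1 / L)) ≤
      ENNReal.ofReal ((if ∀ k ≤ n, S k ω ≠ spiderPoint L j then
      (c ^ bodyVisits (fun k => S k ω) n)⁻¹ else 0) * legWeight L j (S n ω))} := by
    rintro ω ⟨h1, h2⟩
    refine ENNReal.ofReal_le_ofReal ?_
    rw [if_pos h1]
    refine mul_le_mul ?_ (inv_le_legWeight hL (h1 n le_rfl)) (by positivity) (by positivity)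
    exact inv_anti₀ (by positivity) (pow_le_pow_of_le_one hq.le hq1 h2)
  have hm := (mul_le_mul_right (measure_mono (μ := μ) hsub) _).trans
    ((mul_meas_ge_le_lintegral₀ ?_ (ENNReal.ofReal ((c ^ m)⁻¹ * (1 / L)))).trans key)
  · have h := ENNReal.toReal_mono ENNReal.one_ne_top hm
    rw [ENNReal.toReal_mul, ENNReal.toReal_ofReal (by positivity), ENNReal.toReal_one] at h
    change _ * μ.real E ≤ 1 at h
    field_simp at h
    linarith
  · have hd : DependsOn (fun x : ℕ → SpiderVertex N => ENNReal.ofReal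
        ((if ∀ k ≤ n, x k ≠ spiderPoint L j then (c ^ bodyVisits x n)⁻¹ else 0) *
          legWeight L j (x n))) (Set.Iic n) := by
      intro x y h
      have h1 := dependsOn_not_visited n (spiderPoint L j) h
      have h2 : bodyVisits x n = bodyVisits y n := by
        cases n with
        | zero => rfl
        | succ n => exact dependsOn_bodyVisits n fun k hk => h k (by simp at hk ⊢; omega)
      simp only at h1
      simp only [h2, h1, h n (Set.mem_Iic.2 le_rfl)]
    exact (hS.measurable_path hd).aemeasurable

/-! ### Few visits to the body -/

theorem spiderAverage_pow_height_leg {N : ℕ} (p : Fin N → ℝ) (b : ℝ) (j : Fin N) (r : ℕ) :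
    2 * b * spiderAverage p (fun v => b ^ spiderHeight v) (.leg j r) =
      (1 + b ^ 2) * b ^ spiderHeight (.leg j r : SpiderVertex N) := by
  cases r <;> simp only [spiderAverage, spiderHeight, spiderPoint] <;> ring

theorem spiderAverage_pow_height_body {N : ℕ} {p : Fin N → ℝ} (hp : ∑ j, p j = 1) (b : ℝ) :
    spiderAverage p (fun v => b ^ spiderHeight v) .body = b := by
  simp only [spiderAverage, spiderHeight]
  rw [← Finset.sum_mul, hp]
  ring

theorem measurableSet_bodyVisits_lt {N : ℕ} {Ω : Type*} [MeasurableSpace Ω]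
    {μ : Measure Ω} {p : Fin N → ℝ} {S : ℕ → Ω → SpiderVertex N} (hS : IsSpiderWalk μ p S)
    (m n : ℕ) : MeasurableSet {ω | bodyVisits (fun k => S k ω) n < m} := by
  have h : Measurable fun ω => bodyVisits (fun k => S k ω) n := by
    cases n with
    | zero => simp only [bodyVisits_zero]; exact measurable_const
    | succ n => exact hS.measurable_path (dependsOn_bodyVisits n)
  exact h measurableSet_Iio

/-- Let `s = 2 b / (1 + b ^ 2)` and `a = s b`. Stopped at the `m`-th visit to the body, the process
`s ^ n * a ^ (m - bodyVisits n) * b ^ height` is a martingale with value `a ^ m` at time `0`; its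
value after stopping is at most `1`, so it is replaced by `1` there. -/
theorem IsSpiderWalk.pow_le_lintegral_add {N : ℕ} {Ω : Type*} [MeasurableSpace Ω]
    {μ : Measure Ω} {p : Fin N → ℝ} {S : ℕ → Ω → SpiderVertex N} (hS : IsSpiderWalk μ p S)
    {b s a : ℝ} (hb0 : 0 < b) (hb1 : b ≤ 1) (hs : s = 2 * b / (1 + b ^ 2)) (ha : a = s * b)
    (m n : ℕ) :
    ENNReal.ofReal (a ^ m) ≤
      ∫⁻ ω, ENNReal.ofReal ((if bodyVisits (fun k => S k ω) n < m then
        s ^ n * a ^ (m - bodyVisits (fun k => S k ω) n) else 0) * b ^ spiderHeight (S n ω)) ∂μ +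
      μ {ω | bodyVisits (fun k => S k ω) n < m}ᶜ := by
  have := hS.prob
  have hs0 : 0 < s := by rw [hs]; positivity
  have hs1 : s ≤ 1 := by
    rw [hs, div_le_one (by positivity)]
    nlinarith [sq_nonneg (1 - b)]
  have ha0 : 0 < a := by rw [ha]; positivity
  have ha1 : a ≤ 1 := by
    rw [ha]
    exact mul_le_one₀ hs1 hb0.le hb1
  have hcompl : ∀ n, μ {ω | bodyVisits (fun k => S k ω) n < m}ᶜ =
      ∫⁻ ω, ENNReal.ofReal (if bodyVisits (fun k => S k ω) n < m then 0 else 1) ∂μ := by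
    intro n
    rw [← lintegral_indicator_one (measurableSet_bodyVisits_lt hS m n).compl]
    refine lintegral_congr fun ω => ?_
    by_cases h : bodyVisits (fun k => S k ω) n < m <;> simp [Set.indicator, h]
  induction n with
  | zero =>
    rcases Nat.eq_zero_or_pos m with rfl | hm
    · simp [bodyVisits_zero]
    refine le_add_right (le_of_eq ?_)
    have h : ∀ᵐ ω ∂μ, ENNReal.ofReal ((if bodyVisits (fun k => S k ω) 0 < m then
        s ^ 0 * a ^ (m - bodyVisits (fun k => S k ω) 0) else 0) * b ^ spiderHeight (S 0 ω)) =
        ENNReal.ofReal (a ^ m) := by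
      filter_upwards [hS.start] with ω hω
      simp [hω, bodyVisits_zero, hm, spiderHeight]
    rw [lintegral_congr_ae h]
    simp
  | succ n ih =>
    let F : (ℕ → SpiderVertex N) → ℝ := fun x =>
      if bodyVisits x (n + 1) < m then s ^ (n + 1) * a ^ (m - bodyVisits x (n + 1)) else 0
    have hF : DependsOn F (Set.Iic n) := by
      intro x y h
      have h2 := dependsOn_bodyVisits n h
      simp only at h2
      simp only [F, h2]
    have hF0 : ∀ x, 0 ≤ F x := by
      intro x
      simp only [F]
      split_ifs <;> positivity
    refine ih.trans ?_
    have hstep := hS.lintegral_step hF hF0 (φ := fun v => b ^ spiderHeight v)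
      (fun v => by positivity)
    change _ ≤ ∫⁻ ω, ENNReal.ofReal (F (fun k => S k ω) * b ^ spiderHeight (S (n + 1) ω)) ∂μ + _
    rw [hstep, hcompl n, hcompl (n + 1)]
    have hmeas : ∀ n, Measurable fun ω =>
        ENNReal.ofReal (if bodyVisits (fun k => S k ω) n < m then 0 else 1) := fun n =>
      ENNReal.measurable_ofReal.comp
        (Measurable.ite (measurableSet_bodyVisits_lt hS m n) measurable_const measurable_const)
    rw [← lintegral_add_right _ (hmeas n), ← lintegral_add_right _ (hmeas (n + 1))]
    refine lintegral_mono fun ω => ?_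
    have hav0 : 0 ≤ spiderAverage p (fun v => b ^ spiderHeight v) (S n ω) := by
      cases S n ω with
      | body => rw [spiderAverage_pow_height_body hS.sum_eq_one]; exact hb0.le
      | leg j r => simp only [spiderAverage]; positivity
    rw [← ENNReal.ofReal_add (by split_ifs <;> positivity) (by split_ifs <;> positivity),
      ← ENNReal.ofReal_add (mul_nonneg (hF0 _) hav0) (by split_ifs <;> positivity)]
    refine ENNReal.ofReal_le_ofReal ?_
    simp only [F, bodyVisits_succ]
    generalize hA : bodyVisits (fun k => S k ω) n = A
    obtain hv | ⟨j, r, hv⟩ : S n ω = .body ∨ ∃ j r, S n ω = .leg j r := by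
      cases S n ω <;> simp
    · simp only [hv, spiderAverage_pow_height_body hS.sum_eq_one, if_true]
      simp only [spiderHeight, pow_zero, mul_one]
      by_cases h1 : A + 1 < m
      · have h2 : A < m := by omega
        obtain ⟨d, rfl⟩ : ∃ d, m = A + 1 + d := ⟨m - (A + 1), by omega⟩
        rw [if_pos h2, if_pos h2, if_pos h1, if_pos h1, show A + 1 + d - A = d + 1 by omega,
          show A + 1 + d - (A + 1) = d by omega, pow_succ a, pow_succ s, ha]
        exact le_of_eq (by ring)
      · rw [if_neg h1, if_neg h1]
        by_cases h2 : A < m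
        · rw [if_pos h2, if_pos h2]
          -- The `m`-th visit happens now: a weight of at most `1` is replaced by `1`.
          have : s ^ n * a ^ (m - A) ≤ 1 :=
            mul_le_one₀ (pow_le_one₀ hs0.le hs1) (by positivity) (pow_le_one₀ ha0.le ha1)
          linarith
        · rw [if_neg h2, if_neg h2]
          linarith
    · have h := spiderAverage_pow_height_leg p b j r
      have h' : b ^ spiderHeight (.leg j r : SpiderVertex N) =
          s * spiderAverage p (fun v => b ^ spiderHeight v) (.leg j r) := by
        rw [hs, div_mul_eq_mul_div, eq_div_iff (by positivity), h]
        ring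
      simp only [hv, reduceCtorEq, if_false, add_zero, h']
      split_ifs
      · exact le_of_eq (by ring)
      · simp

/-- The walk makes fewer than `m` visits to the body before time `n` with probability
`O(m / √n)`. -/
theorem IsSpiderWalk.measureReal_bodyVisits_lt_le {N : ℕ} {Ω : Type*} [MeasurableSpace Ω]
    {μ : Measure Ω} {p : Fin N → ℝ} {S : ℕ → Ω → SpiderVertex N} (hS : IsSpiderWalk μ p S)
    {δ : ℝ} (hδ0 : 0 < δ) (hδ1 : δ < 1) {n : ℕ} (hn : 2 ≤ δ ^ 2 * n) (m : ℕ) :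
    μ.real {ω | bodyVisits (fun k => S k ω) n < m} ≤ 4 * m * δ := by
  have := hS.prob
  set b := 1 - δ with hb
  set s := 2 * b / (1 + b ^ 2) with hs
  have hb0 : 0 < b := by linarith
  have hb1 : b ≤ 1 := by linarith
  have hs0 : 0 < s := by rw [hs]; positivity
  have hs1 : s ≤ 1 - δ ^ 2 / 2 := by
    rw [hs, div_le_iff₀ (by positivity), hb]
    nlinarith [mul_nonneg (sq_nonneg δ) (by nlinarith : 0 ≤ 2 * δ - δ ^ 2)]
  have hs2 : s ≤ 1 := by nlinarith [sq_nonneg δ]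
  have ha : 1 - 2 * δ ≤ s * b := by
    rw [hs, div_mul_eq_mul_div, le_div_iff₀ (by positivity), hb]
    nlinarith [pow_pos hδ0 2, pow_pos hδ0 3]
  have ha0 : 0 < s * b := by positivity
  have ha1 : s * b ≤ 1 := mul_le_one₀ hs2 hb0.le hb1
  have hsn : s ^ n ≤ 1 / 2 := by
    have h1 : s ≤ Real.exp (-(δ ^ 2 / 2)) := by
      have := Real.add_one_le_exp (-(δ ^ 2 / 2))
      linarith
    calc s ^ n ≤ Real.exp (-(δ ^ 2 / 2)) ^ n := pow_le_pow_left₀ hs0.le h1 n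
      _ = Real.exp (-(δ ^ 2 * n / 2)) := by
        rw [← Real.exp_nat_mul]
        ring_nf
      _ ≤ Real.exp (-1) := Real.exp_le_exp.2 (by linarith)
      _ ≤ 1 / 2 := by
        rw [Real.exp_neg, one_div]
        exact inv_anti₀ (by norm_num) (by linarith [Real.add_one_le_exp 1])
  have ham : 1 - 2 * m * δ ≤ (s * b) ^ m := by
    have h := one_add_mul_le_pow (a := s * b - 1) (by linarith) m
    rw [add_sub_cancel] at h
    nlinarith [(Nat.cast_nonneg m : (0 : ℝ) ≤ m)]
  set E := {ω | bodyVisits (fun k => S k ω) n < m}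
  have hE : MeasurableSet E := measurableSet_bodyVisits_lt hS m n
  have key := hS.pow_le_lintegral_add hb0 hb1 hs rfl m n
  have hint : ∫⁻ ω, ENNReal.ofReal ((if bodyVisits (fun k => S k ω) n < m then
        s ^ n * (s * b) ^ (m - bodyVisits (fun k => S k ω) n) else 0) *
          b ^ spiderHeight (S n ω)) ∂μ ≤ ENNReal.ofReal (1 / 2) * μ E := by
    rw [← lintegral_indicator_const hE]
    refine lintegral_mono fun ω => ?_
    by_cases h : bodyVisits (fun k => S k ω) n < m
    · rw [if_pos h, Set.indicator_of_mem (show ω ∈ E from h)]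
      refine ENNReal.ofReal_le_ofReal ?_
      calc s ^ n * (s * b) ^ (m - bodyVisits (fun k => S k ω) n) * b ^ spiderHeight (S n ω)
          _ ≤ 1 / 2 * 1 * 1 := by
              gcongr
              · exact pow_le_one₀ ha0.le ha1
              · exact pow_le_one₀ hb0.le hb1
          _ = 1 / 2 := by norm_num
    · simp [h]
  have h := ENNReal.toReal_mono (by finiteness) (key.trans (add_le_add_left hint _))
  rw [ENNReal.toReal_ofReal (by positivity), ENNReal.toReal_add (by finiteness) (by finiteness),
    ENNReal.toReal_mul, ENNReal.toReal_ofReal (by norm_num)] at h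
  change _ ≤ 1 / 2 * μ.real E + μ.real Eᶜ at h
  rw [probReal_compl_eq_one_sub hE] at h
  linarith

/-! ### The probability of reaching height `L` on every leg -/

theorem one_le_spiderLocalTime_iff {N : ℕ} {Ω : Type*} 
    (S : ℕ → Ω → SpiderVertex N) (v : SpiderVertex N) (n : ℕ) (ω : Ω) :
    1 ≤ spiderLocalTime S v n ω ↔ ∃ k ≤ n, S k ω = v := by
  simp [spiderLocalTime, Nat.one_le_iff_ne_zero, Finset.filter_eq_empty_iff]

theorem IsSpiderWalk.measurableSet_spiderReachEvent {N : ℕ} {Ω : Type*} [MeasurableSpace Ω]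
    {μ : Measure Ω} {p : Fin N → ℝ} {S : ℕ → Ω → SpiderVertex N} (hS : IsSpiderWalk μ p S)
    (n L : ℕ) : MeasurableSet (spiderReachEvent S n L) := by
  simp only [spiderReachEvent, one_le_spiderLocalTime_iff, Set.ofPred_forall, Set.ofPred_exists,
    Set.ofPred_and]
  exact MeasurableSet.iInter fun j => MeasurableSet.iUnion fun k =>
    (MeasurableSet.const _).inter (hS.measurable k (MeasurableSet.of_discrete (s := {_})))

theorem IsSpiderWalk.measureReal_spiderReachEvent_zero {N : ℕ} {Ω : Type*} [MeasurableSpace Ω]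
    {μ : Measure Ω} {p : Fin N → ℝ} {S : ℕ → Ω → SpiderVertex N} (hS : IsSpiderWalk μ p S)
    (n : ℕ) : μ.real (spiderReachEvent S n 0) = 1 := by
  have := hS.prob
  have h : ∀ᵐ ω ∂μ, ω ∈ spiderReachEvent S n 0 := by
    filter_upwards [hS.start] with ω hω j
    exact (one_le_spiderLocalTime_iff _ _ _ _).2 ⟨0, Nat.zero_le _, hω⟩
  have h1 := (prob_compl_eq_zero_iff (hS.measurableSet_spiderReachEvent n 0)).1 h
  simp [measureReal_def, h1]

/-- Either the walk makes few excursions, or one of the `N` legs is missed by many of them. -/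
theorem IsSpiderWalk.measureReal_compl_spiderReachEvent_le {N : ℕ} {Ω : Type*}
    [MeasurableSpace Ω] {μ : Measure Ω} {S : ℕ → Ω → SpiderVertex N}
    (hS : IsSpiderWalk μ (fun _ : Fin N => 1 / (N : ℝ)) S) (hN : 2 ≤ N) {L : ℕ} (hL : 1 ≤ L)
    {δ : ℝ} (hδ0 : 0 < δ) (hδ1 : δ < 1) {n : ℕ} (hn : 2 ≤ δ ^ 2 * n) (m : ℕ) :
    μ.real (spiderReachEvent S n L)ᶜ ≤
      4 * m * δ + N * (L * (1 - 1 / (N * L : ℝ)) ^ m) := by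
  have := hS.prob
  have hsub : (spiderReachEvent S n L)ᶜ ⊆ {ω | bodyVisits (fun k => S k ω) n < m} ∪
      ⋃ j, {ω | (∀ k ≤ n, S k ω ≠ spiderPoint L j) ∧ m ≤ bodyVisits (fun k => S k ω) n} := by
    intro ω hω
    have hω' : ¬ ∀ j, 1 ≤ spiderLocalTime S (spiderPoint L j) n ω := hω
    simp only [one_le_spiderLocalTime_iff, not_forall, not_exists, not_and] at hω'
    obtain ⟨j, hj⟩ := hω'
    rcases lt_or_ge (bodyVisits (fun k => S k ω) n) m with h | h
    · exact Or.inl h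
    · exact Or.inr (Set.mem_iUnion.2 ⟨j, hj, h⟩)
  refine (measureReal_mono hsub).trans ((measureReal_union_le _ _).trans (add_le_add
    (hS.measureReal_bodyVisits_lt_le hδ0 hδ1 hn m) ((measureReal_iUnion_fintype_le _).trans ?_)))
  refine (Finset.sum_le_sum fun j _ => hS.measureReal_not_visited_le hN hL j n m).trans ?_
  simp

/-- For `m` of order `3 N L log N` the excursions cover all legs, and `m / √n` is of order
`1 / f`. -/
theorem IsSpiderWalk.one_sub_le_measureReal_spiderReachEvent {N : ℕ} {Ω : Type*}
    [MeasurableSpace Ω] {μ : Measure Ω} {S : ℕ → Ω → SpiderVertex N}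
    (hS : IsSpiderWalk μ (fun _ : Fin N => 1 / (N : ℝ)) S) (hN : 3 ≤ N) {L : ℕ}
    (hL : (L : ℝ) ≤ N / Real.log N) {f : ℝ} (hf : 3 ≤ f) :
    1 - (32 / f + 1 / N) ≤ μ.real (spiderReachEvent S ⌊(f * L * N * Real.log N) ^ 2⌋₊ L) := by
  have := hS.prob
  rcases Nat.eq_zero_or_pos L with rfl | hL1
  · rw [hS.measureReal_spiderReachEvent_zero]
    have : 0 ≤ 32 / f + 1 / (N : ℝ) := by positivity
    linarith
  have hN3 : (3 : ℝ) ≤ N := by exact_mod_cast hN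
  have hL1' : (1 : ℝ) ≤ L := by exact_mod_cast hL1
  -- `3 ≤ N` ensures `exp 1 ≤ N`.
  have hlog : 1 ≤ Real.log N := by
    rw [Real.le_log_iff_exp_le (by linarith)]
    linarith [Real.exp_one_lt_d9]
  have hLN : (L : ℝ) ≤ N := hL.trans (div_le_self (by linarith) hlog)
  set g := (L : ℝ) * N * Real.log N with hg
  have hg1 : 1 ≤ g := by
    rw [hg]
    exact one_le_mul_of_one_le_of_one_le
      (one_le_mul_of_one_le_of_one_le hL1' (by linarith)) hlog
  have hfg : 3 ≤ f * g := by nlinarith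
  have hfg' : f * L * N * Real.log N = f * g := by rw [hg]; ring
  rw [hfg']
  -- `m` excursions suffice to cover all legs, and `δ` is the scale at which `δ ^ 2 * n ≥ 2`.
  set n := ⌊(f * g) ^ 2⌋₊ with hn
  set m := ⌈3 * g⌉₊ with hm
  have hn1 : (f * g) ^ 2 - 1 < n := Nat.sub_one_lt_floor _
  have hm1 : (m : ℝ) ≤ 4 * g := by
    have := Nat.ceil_lt_add_one (by linarith : 0 ≤ 3 * g)
    linarith
  have hm2 : 3 * g ≤ m := Nat.le_ceil _
  have hδn : 2 ≤ (2 / (f * g)) ^ 2 * n := by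
    rw [div_pow, div_mul_eq_mul_div, le_div_iff₀ (by positivity)]
    nlinarith
  have key := hS.measureReal_compl_spiderReachEvent_le (by omega) hL1
    (δ := 2 / (f * g)) (by positivity) (by rw [div_lt_one] <;> linarith) hδn m
  rw [probReal_compl_eq_one_sub (hS.measurableSet_spiderReachEvent n L)] at key
  have h1 : 4 * (m : ℝ) * (2 / (f * g)) ≤ 32 / f := by
    calc 4 * (m : ℝ) * (2 / (f * g)) ≤ 4 * (4 * g) * (2 / (f * g)) := by gcongr
      _ = 32 / f := by
        field_simp
        norm_num
  have hNL : (1 : ℝ) ≤ N * L := one_le_mul_of_one_le_of_one_le (by linarith) hL1'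
  have hq : 0 ≤ 1 - 1 / (N * L : ℝ) := by
    rw [sub_nonneg]
    exact div_le_one_of_le₀ hNL (by linarith)
  have h2 : (1 - 1 / (N * L : ℝ)) ^ m ≤ 1 / (N : ℝ) ^ 3 := by
    calc (1 - 1 / (N * L : ℝ)) ^ m ≤ Real.exp (-(1 / (N * L : ℝ))) ^ m := by
          gcongr
          linarith [Real.add_one_le_exp (-(1 / (N * L : ℝ)))]
      _ = Real.exp (-(m / (N * L : ℝ))) := by
          rw [← Real.exp_nat_mul]
          ring_nf
      _ ≤ Real.exp (-(3 * Real.log N)) := by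
          refine Real.exp_le_exp.2 (neg_le_neg ?_)
          rw [le_div_iff₀ (by linarith)]
          linarith
      _ = 1 / (N : ℝ) ^ 3 := by
          rw [Real.exp_neg, one_div, mul_comm, Real.exp_mul, Real.exp_log (by linarith)]
          norm_cast
  have h3 : (N : ℝ) * (L * (1 - 1 / (N * L : ℝ)) ^ m) ≤ 1 / N := by
    calc (N : ℝ) * (L * (1 - 1 / (N * L : ℝ)) ^ m) ≤ N * (N * (1 / (N : ℝ) ^ 3)) := by
          gcongr
      _ = 1 / N := by field_simp
  linarith

theorem theorem5p3
    (Ω : ℕ → Type*) [∀ N, MeasurableSpace (Ω N)] (μ : ∀ N, Measure (Ω N))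
    (S : ∀ N, ℕ → Ω N → SpiderVertex N)
    (hS : ∀ N, 1 ≤ N → IsSpiderWalk (μ N) (fun _ : Fin N => 1 / (N : ℝ)) (S N))
    (L : ℕ → ℕ) (hL : ∀ N, 2 ≤ N → (L N : ℝ) ≤ N / Real.log N)
    (f : ℕ → ℝ) (hf : Tendsto f atTop atTop) :
    Tendsto
      (fun N : ℕ =>
        (μ N).real
          (spiderReachEvent (S N) ⌊(f N * L N * N * Real.log N) ^ 2⌋₊ (L N)))
      atTop (𝓝 1) := by
  have hlim : Tendsto (fun N : ℕ => 1 - (32 / f N + 1 / (N : ℝ))) atTop (𝓝 1) := by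
    simpa using (tendsto_const_nhds (x := (1 : ℝ))).sub
      ((hf.const_div_atTop 32).add tendsto_one_div_atTop_nhds_zero_nat)
  refine tendsto_of_tendsto_of_tendsto_of_le_of_le' hlim tendsto_const_nhds ?_ ?_
  · filter_upwards [hf.eventually_ge_atTop 3, eventually_ge_atTop 3] with N hfN hN
    exact (hS N (by omega)).one_sub_le_measureReal_spiderReachEvent hN (hL N (by omega)) hfN
  · filter_upwards [eventually_ge_atTop 1] with N hN
    have := (hS N hN).prob
    exact measureReal_le_one
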